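/- Let $R$ be an associative, not necessarily commutative, ring with unit. A left $R$-pairing $P=(V,W)$ consists of a right $R$-module $V$, a left $R$-module $W$ and a map $\kappa_P:V\to{}^*W=\mathrm{Hom}_{R-}(W,R)$ of right $R$-modules; write $\langle v,w\rangle=\kappa_P(v)(w)$, let $V^*=\mathrm{Hom}_{-R}(V,R)$, and let $\chi_P:W\to V^*$, $w\mapsto\langle -,w\rangle$, be the induced map of left $R$-modules. The pairing $P$ is an $\alpha$-pairing if for every right $R$-module $M$ the map $$\alpha_M^P:M\otimes_R W\to\mathrm{Hom}_{-R}(V,M),\qquad \sum m_i\otimes w_i\mapsto\Big[v\mapsto\sum m_i\langle v,w_i\rangle\Big]$$ is injective. The pairing $P$ is dense if $\kappa_P(V)$ is dense in ${}^*W$ for the finite topology, that is, the topology induced from the product topology on $R^W$ with $R$ discrete. The left module $W$ satisfies the $\alpha$-condition if the evaluation pairing $({}^*W,W)$ is an $\alpha$-pairing. It is locally projective if for every surjection $\pi:L\to N$ of left $R$-modules, every $R$-linear $g:W\to N$ and every finitely generated submodule $F\subseteq W$ there is an $R$-linear $g':W\to L$ with $\pi\circ g'|_F=g|_F$. An embedding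 $f:W\to W'$ of left $R$-modules is pure if $\mathrm{id}_M\otimes f:M\otimes_R W\to M\otimes_R W'$ is injective for every right $R$-module $M$. The ring $R$ is QF if $R_R$ is Noetherian and a cogenerator of the category of right $R$-modules. Let $P=(V,W)$ be a left $R$-pairing. (1) If $R_R$ is injective and a cogenerator of the category of right $R$-modules, then the following are equivalent: (i) $_RW$ is locally projective and $P$ is dense; (ii) $W$ satisfies the $\alpha$-condition and $P$ is dense; (ii$'$) $P$ is an $\alpha$-pairing; (iii) $W$ satisfies the $\alpha$-condition and $\chi_P:W\to V^*$ is injective. (2) If $R$ is a QF ring, then (i), (ii), (ii$'$), (iii) are equivalent to each other and to each of: (iv) $_RW$ is projective and $\chi_P:W\to V^*$ is injective; (v) the map $W\to R^V$, $w\mapsto(v\mapsto\langle v,w\rangle)$, is a pure embedding of left $R$-modules. -/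

import Mathlib

open scoped TensorProduct

universe u

/-! Conventions: `R` is an associative unital ring, not necessarily commutative. A right `R`-module
is a module over `Rᵐᵒᵖ`, with `m * r` written `MulOpposite.op r • m`. For a left module `W`, the
dual `W →ₗ[R] R` is a right module through `(f * r) w = f w * r`; for a right module `V`, the dual
`V →ₗ[Rᵐᵒᵖ] R` is a left module through `(r * f) v = r * f v`. -/

/-! ### Tensor product of a right module and a left module -/

/-- The relations `(m * r) ⊗ w = m ⊗ (r * w)` in `M ⊗[ℤ] W`. -/
def balancedRelations (R M W : Type*) [Ring R] [AddCommGroup M] [Module Rᵐᵒᵖ M]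
    [AddCommGroup W] [Module R W] : AddSubgroup (M ⊗[ℤ] W) :=
  AddSubgroup.closure {t | ∃ (m : M) (r : R) (w : W),
    t = (MulOpposite.op r • m) ⊗ₜ[ℤ] w - m ⊗ₜ[ℤ] (r • w)}

/-- The abelian group `M ⊗_R W` for a right `R`-module `M` and a left `R`-module `W`. -/
abbrev BalancedTensor (R M W : Type*) [Ring R] [AddCommGroup M] [Module Rᵐᵒᵖ M]
    [AddCommGroup W] [Module R W] : Type _ :=
  (M ⊗[ℤ] W) ⧸ balancedRelations R M W

namespace BalancedTensor

/-- The pure tensor `m ⊗ w` in `M ⊗_R W`. -/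
def tmul (R : Type*) {M W : Type*} [Ring R] [AddCommGroup M] [Module Rᵐᵒᵖ M]
    [AddCommGroup W] [Module R W] (m : M) (w : W) : BalancedTensor R M W :=
  QuotientAddGroup.mk (m ⊗ₜ[ℤ] w)

theorem add_tmul {R M W : Type*} [Ring R] [AddCommGroup M] [Module Rᵐᵒᵖ M]
    [AddCommGroup W] [Module R W] (m m' : M) (w : W) :
    tmul R (m + m') w = tmul R m w + tmul R m' w :=
  congrArg QuotientAddGroup.mk (TensorProduct.add_tmul m m' w)

theorem tmul_add {R M W : Type*} [Ring R] [AddCommGroup M] [Module Rᵐᵒᵖ M]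
    [AddCommGroup W] [Module R W] (m : M) (w w' : W) :
    tmul R m (w + w') = tmul R m w + tmul R m w' :=
  congrArg QuotientAddGroup.mk (TensorProduct.tmul_add m w w')

theorem smul_tmul {R M W : Type*} [Ring R] [AddCommGroup M] [Module Rᵐᵒᵖ M]
    [AddCommGroup W] [Module R W] (m : M) (r : R) (w : W) :
    tmul R (MulOpposite.op r • m) w = tmul R m (r • w) := by
  refine (QuotientAddGroup.eq_iff_sub_mem).2 ?_
  exact AddSubgroup.subset_closure ⟨m, r, w, rfl⟩

/-- The additive map out of `M ⊗_R W` induced by a biadditive `R`-balanced map. -/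
def lift {R M W A : Type*} [Ring R] [AddCommGroup M] [Module Rᵐᵒᵖ M]
    [AddCommGroup W] [Module R W] [AddCommGroup A] (f : M →+ W →+ A)
    (hf : ∀ (m : M) (r : R) (w : W), f (MulOpposite.op r • m) w = f m (r • w)) :
    BalancedTensor R M W →+ A :=
  QuotientAddGroup.lift (balancedRelations R M W)
    (TensorProduct.liftAddHom f (fun z m w => by simp)) (by
      rw [balancedRelations, AddSubgroup.closure_le]
      rintro _ ⟨m, r, w, rfl⟩
      simp [hf])

theorem lift_tmul {R M W A : Type*} [Ring R] [AddCommGroup M] [Module Rᵐᵒᵖ M]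
    [AddCommGroup W] [Module R W] [AddCommGroup A] (f : M →+ W →+ A)
    (hf : ∀ (m : M) (r : R) (w : W), f (MulOpposite.op r • m) w = f m (r • w))
    (m : M) (w : W) : lift f hf (tmul R m w) = f m w := by
  simp [lift, tmul]

/-- The map `id_M ⊗ f : M ⊗_R W → M ⊗_R W'` induced by an `R`-linear map `f : W → W'`. -/
def lTensor {R : Type*} (M : Type*) {W W' : Type*} [Ring R] [AddCommGroup M] [Module Rᵐᵒᵖ M]
    [AddCommGroup W] [Module R W] [AddCommGroup W'] [Module R W'] (f : W →ₗ[R] W') :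
    BalancedTensor R M W →+ BalancedTensor R M W' :=
  lift
    (AddMonoidHom.mk'
      (fun m => AddMonoidHom.mk' (fun w => tmul R m (f w)) (fun w w' => by simp [tmul_add]))
      (fun m m' => by ext w; simp [add_tmul]))
    (fun m r w => by simp [smul_tmul])

theorem lTensor_tmul {R M W W' : Type*} [Ring R] [AddCommGroup M] [Module Rᵐᵒᵖ M]
    [AddCommGroup W] [Module R W] [AddCommGroup W'] [Module R W'] (f : W →ₗ[R] W')
    (m : M) (w : W) : lTensor M f (tmul R m w) = tmul R m (f w) := by
  simp [lTensor, lift_tmul]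

end BalancedTensor

/-! ### Left pairings

A left `R`-pairing `(V, W)` is given by an `R`-linear map `κ : V → *W`, where `V` is a right module,
`W` is a left module and `*W` is the left dual of `W`; one writes `⟨v, w⟩ = κ v w`. -/

namespace LeftPairing

/-- The map `χ : W → V^*`, `χ w v = ⟨v, w⟩`. -/
def chi {R V W : Type*} [Ring R] [AddCommGroup V] [Module Rᵐᵒᵖ V] [AddCommGroup W] [Module R W]
    (κ : V →ₗ[Rᵐᵒᵖ] (W →ₗ[R] R)) : W →ₗ[R] (V →ₗ[Rᵐᵒᵖ] R) where
  toFun w :=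
    { toFun := fun v => κ v w
      map_add' := fun v v' => by simp
      map_smul' := fun r v => by simp }
  map_add' w w' := by ext v; simp
  map_smul' r w := by ext v; simp

/-- The map `W → R^V`, `w ↦ (v ↦ ⟨v, w⟩)`, that is, `χ` followed by the inclusion `V^* ⊆ R^V`. -/
def chiFun {R V W : Type*} [Ring R] [AddCommGroup V] [Module Rᵐᵒᵖ V] [AddCommGroup W] [Module R W]
    (κ : V →ₗ[Rᵐᵒᵖ] (W →ₗ[R] R)) : W →ₗ[R] (V → R) where
  toFun w v := chi κ w v
  map_add' w w' := by ext v; simp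
  map_smul' r w := by ext v; simp

/-- The canonical map `α_M : M ⊗_R W → Hom_R(V, M)`, `m ⊗ w ↦ (v ↦ m * ⟨v, w⟩)`. -/
def alphaMap {R V W : Type*} [Ring R] [AddCommGroup V] [Module Rᵐᵒᵖ V]
    [AddCommGroup W] [Module R W] (κ : V →ₗ[Rᵐᵒᵖ] (W →ₗ[R] R))
    (M : Type*) [AddCommGroup M] [Module Rᵐᵒᵖ M] :
    BalancedTensor R M W →+ (V →ₗ[Rᵐᵒᵖ] M) :=
  BalancedTensor.lift
    (AddMonoidHom.mk'
      (fun m => AddMonoidHom.mk'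
        (fun w =>
          ({ toFun := fun v => MulOpposite.op (κ v w) • m
             map_add' := fun v v' => by simp [add_smul]
             map_smul' := fun r v => by simp [mul_smul] } : V →ₗ[Rᵐᵒᵖ] M))
        (fun w w' => by ext v; simp [add_smul]))
      (fun m m' => by ext w v; simp))
    (fun m r w => by ext v; simp [mul_smul])

theorem alphaMap_tmul {R V W : Type*} [Ring R] [AddCommGroup V] [Module Rᵐᵒᵖ V]
    [AddCommGroup W] [Module R W] (κ : V →ₗ[Rᵐᵒᵖ] (W →ₗ[R] R))
    {M : Type*} [AddCommGroup M] [Module Rᵐᵒᵖ M] (m : M) (w : W) (v : V) :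
    alphaMap κ M (BalancedTensor.tmul R m w) v = MulOpposite.op (κ v w) • m := by
  simp [alphaMap, BalancedTensor.lift_tmul]

/-- `(V, W)` is an `α`-pairing: `α_M` is injective for every right `R`-module `M`. -/
def IsAlpha {R V W : Type u} [Ring R] [AddCommGroup V] [Module Rᵐᵒᵖ V]
    [AddCommGroup W] [Module R W] (κ : V →ₗ[Rᵐᵒᵖ] (W →ₗ[R] R)) : Prop :=
  ∀ (M : Type u) [AddCommGroup M] [Module Rᵐᵒᵖ M], Function.Injective (alphaMap κ M)

/-- The finite topology on `*W`: the topology induced by the product topology on `R^W`, where `R`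
is discrete. -/
@[reducible] def finiteTopology (R W : Type*) [Ring R] [AddCommGroup W] [Module R W] :
    TopologicalSpace (W →ₗ[R] R) :=
  TopologicalSpace.induced (fun f => (f : W → R))
    (@Pi.topologicalSpace W (fun _ => R) (fun _ => ⊥))

/-- `(V, W)` is dense: `κ(V)` is dense in `*W` for the finite topology. -/
def IsDense {R V W : Type*} [Ring R] [AddCommGroup V] [Module Rᵐᵒᵖ V]
    [AddCommGroup W] [Module R W] (κ : V →ₗ[Rᵐᵒᵖ] (W →ₗ[R] R)) : Prop :=
  @Dense (W →ₗ[R] R) (finiteTopology R W) (Set.range κ)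

end LeftPairing

/-! ### Conditions on modules and rings -/

/-- A left module `W` satisfies the `α`-condition if the evaluation pairing `(*W, W)` does. -/
def SatisfiesAlpha (R W : Type u) [Ring R] [AddCommGroup W] [Module R W] : Prop :=
  LeftPairing.IsAlpha (LinearMap.id : (W →ₗ[R] R) →ₗ[Rᵐᵒᵖ] (W →ₗ[R] R))

/-- A module `W` is locally projective if, for every surjection `π : L → N`, every `g : W → N` and
every finitely generated `F ⊆ W`, some `g' : W → L` satisfies `π ∘ g' = g` on `F`. -/
def IsLocallyProjective (R W : Type u) [Ring R] [AddCommGroup W] [Module R W] : Prop :=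
  ∀ (L N : Type u) [AddCommGroup L] [Module R L] [AddCommGroup N] [Module R N]
    (π : L →ₗ[R] N) (g : W →ₗ[R] N) (F : Submodule R W),
    Function.Surjective π → F.FG → ∃ g' : W →ₗ[R] L, ∀ x ∈ F, π (g' x) = g x

/-- `f : W → W'` is the embedding of a pure submodule (in the sense of Cohn): it is injective, and
so is `id_M ⊗ f` for every right module `M`. -/
def IsPureEmbedding {R W W' : Type u} [Ring R] [AddCommGroup W] [Module R W]
    [AddCommGroup W'] [Module R W'] (f : W →ₗ[R] W') : Prop :=
  Function.Injective f ∧ ∀ (M : Type u) [AddCommGroup M] [Module Rᵐᵒᵖ M],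
    Function.Injective (BalancedTensor.lTensor M f)

/-- `U` is a cogenerator of the category of `S`-modules: the homomorphisms into `U` separate the
elements of every `S`-module. -/
def IsCogenerator (S U : Type u) [Ring S] [AddCommGroup U] [Module S U] : Prop :=
  ∀ (N : Type u) [AddCommGroup N] [Module S N] (n : N), n ≠ 0 → ∃ f : N →ₗ[S] U, f n ≠ 0

/-- `R` is a QF (quasi-Frobenius) ring: the right module `R_R` is Noetherian and a cogenerator. -/
def IsQFRing (R : Type u) [Ring R] : Prop :=
  IsNoetherian Rᵐᵒᵖ R ∧ IsCogenerator Rᵐᵒᵖ R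

/-! Everything passes through local dual bases: on each finite subset of `W`, `w = ∑ ⟨vⱼ, w⟩ uⱼ`.
For any pairing this is the α-property (`isAlpha_iff`); for the evaluation pairing it is local
projectivity (`isLocallyProjective_iff`). Density replaces functionals by elements of `V`;
conversely, over a cogenerator ring, injectivity of `χ` forces density. Over a right Noetherian
ring, finitely many functions `X → R` are reproduced from finitely many points of `X`, so purity in
`R^V` gives the α-property.

It remains to make locally projective modules projective over a QF ring. The cogenerator property
makes injective hulls of simples of the form `A e`, `A = Rᵐᵒᵖ`, with `e` local. Distinct socles have
distinct tops, so by finiteness every simple is a top. Double annihilators make the radical `J`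
nilpotent. Then a basis of the semisimple module `W / JW` lifts to a cover of `W` by some `⨁ R e`,
and local projectivity pushes its kernel into every power of `J`, hence to zero. -/

namespace BalancedTensor

variable {R M W : Type*} [Ring R] [AddCommGroup M] [Module Rᵐᵒᵖ M] [AddCommGroup W] [Module R W]

theorem tmul_zero (m : M) : tmul R m (0 : W) = 0 :=
  congrArg QuotientAddGroup.mk (TensorProduct.tmul_zero W m)

theorem zero_tmul (w : W) : tmul R (0 : M) w = 0 :=
  congrArg QuotientAddGroup.mk (TensorProduct.zero_tmul M w)

theorem tmul_list_sum {ι : Type*} (m : M) (l : List ι) (f : ι → W) :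
    tmul R m (l.map f).sum = (l.map fun i => tmul R m (f i)).sum := by
  induction l with
  | nil => simp [tmul_zero]
  | cons a l ih => simp [tmul_add, ih]

@[elab_as_elim]
theorem induction_on {P : BalancedTensor R M W → Prop} (t : BalancedTensor R M W) (zero : P 0)
    (tmul : ∀ m w, P (tmul R m w)) (add : ∀ s t, P s → P t → P (s + t)) : P t := by
  induction t using QuotientAddGroup.induction_on with
  | H t =>
    induction t using TensorProduct.induction_on with
    | zero => exact zero
    | tmul m w => exact tmul m w
    | add s t hs ht => exact add _ _ hs ht

end BalancedTensor

/-! ### Local dual bases and the α-property -/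

namespace LeftPairing

section

variable {R V W : Type*} [Ring R] [AddCommGroup V] [Module Rᵐᵒᵖ V] [AddCommGroup W] [Module R W]

/-- Every finite subset of `W` is reproduced by finitely many `vⱼ ∈ V` and `uⱼ ∈ W`, through
`w = ∑ ⟨vⱼ, w⟩ uⱼ`. -/
def HasLocalDualBases (κ : V →ₗ[Rᵐᵒᵖ] (W →ₗ[R] R)) : Prop :=
  ∀ s : Finset W, ∃ l : List (V × W), ∀ w ∈ s, w = (l.map fun p => κ p.1 w • p.2).sum

/-- Write `t = ∑ mᵢ ⊗ wᵢ`, take `s = {wᵢ}`, expand each `f wᵢ` and move the scalars across the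
tensor sign. It is used for the identity and for `chiFun κ`. -/
theorem exists_finset_lTensor_eq {W' : Type*} [AddCommGroup W'] [Module R W']
    (κ : V →ₗ[Rᵐᵒᵖ] (W →ₗ[R] R)) {M : Type*} [AddCommGroup M] [Module Rᵐᵒᵖ M] (f : W →ₗ[R] W')
    (t : BalancedTensor R M W) :
    ∃ s : Finset W, ∀ l : List (V × W'), (∀ w ∈ s, f w = (l.map fun p => κ p.1 w • p.2).sum) →
      BalancedTensor.lTensor M f t =
        (l.map fun p => BalancedTensor.tmul R (alphaMap κ M t p.1) p.2).sum := by
  classical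
  induction t using BalancedTensor.induction_on with
  | zero => exact ⟨∅, fun l _ => by simp [BalancedTensor.zero_tmul]⟩
  | tmul m w =>
    refine ⟨{w}, fun l hl => ?_⟩
    rw [BalancedTensor.lTensor_tmul, hl w (by simp), BalancedTensor.tmul_list_sum]
    simp [alphaMap_tmul, BalancedTensor.smul_tmul]
  | add t₁ t₂ h₁ h₂ =>
    obtain ⟨s₁, h₁⟩ := h₁
    obtain ⟨s₂, h₂⟩ := h₂
    refine ⟨s₁ ∪ s₂, fun l hl => ?_⟩
    rw [map_add, h₁ l fun w hw => hl w (by simp [hw]), h₂ l fun w hw => hl w (by simp [hw]),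
      ← List.sum_map_add]
    simp [BalancedTensor.add_tmul]

theorem lTensor_id {M : Type*} [AddCommGroup M] [Module Rᵐᵒᵖ M] (t : BalancedTensor R M W) :
    BalancedTensor.lTensor M (LinearMap.id : W →ₗ[R] W) t = t := by
  induction t using BalancedTensor.induction_on with
  | zero => simp
  | tmul m w => simp [BalancedTensor.lTensor_tmul]
  | add t₁ t₂ h₁ h₂ => rw [map_add, h₁, h₂]

theorem HasLocalDualBases.alphaMap_injective {κ : V →ₗ[Rᵐᵒᵖ] (W →ₗ[R] R)}
    (h : HasLocalDualBases κ) (M : Type*) [AddCommGroup M] [Module Rᵐᵒᵖ M] :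
    Function.Injective (alphaMap κ M) := by
  rw [injective_iff_map_eq_zero]
  intro t ht
  obtain ⟨s, hs⟩ := exists_finset_lTensor_eq κ LinearMap.id t
  obtain ⟨l, hl⟩ := h s
  rw [← lTensor_id t, hs l hl, ht]
  simp [BalancedTensor.zero_tmul]

/-- The values of `V` on a family of elements of `W`. -/
def evalFamily {ι : Type*} (κ : V →ₗ[Rᵐᵒᵖ] (W →ₗ[R] R)) (x : ι → W) : V →ₗ[Rᵐᵒᵖ] (ι → R) where
  toFun v i := κ v (x i)
  map_add' v v' := by ext; simp
  map_smul' r v := by ext; simp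

theorem exists_list_of_mem_closure {ι : Type*} {κ : V →ₗ[Rᵐᵒᵖ] (W →ₗ[R] R)} {x : ι → W}
    {y : ι → W} (hy : y ∈ AddSubgroup.closure
      {z : ι → W | ∃ (v : V) (w : W), z = fun i => κ v (x i) • w}) :
    ∃ l : List (V × W), ∀ i, y i = (l.map fun p => κ p.1 (x i) • p.2).sum := by
  induction hy using AddSubgroup.closure_induction with
  | mem z hz =>
    obtain ⟨v, w, rfl⟩ := hz
    exact ⟨[(v, w)], fun i => by simp⟩
  | zero => exact ⟨[], fun i => by simp⟩
  | add y z _ _ hy hz =>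
    obtain ⟨l, hl⟩ := hy
    obtain ⟨l', hl'⟩ := hz
    exact ⟨l ++ l', fun i => by simp [hl, hl']⟩
  | neg y _ hy =>
    obtain ⟨l, hl⟩ := hy
    refine ⟨l.map fun p => (-p.1, p.2), fun i => ?_⟩
    rw [Pi.neg_apply, hl]
    clear hl
    induction l with
    | nil => simp
    | cons a l ih => simpa [add_comm] using ih

end

section

variable {R V W : Type u} [Ring R] [AddCommGroup V] [Module Rᵐᵒᵖ V] [AddCommGroup W] [Module R W]
  {κ : V →ₗ[Rᵐᵒᵖ] (W →ₗ[R] R)}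

/-- Test on `M = R^s / K`, where `K` consists of the values of `V` on `s`. The tensor `∑ ēᵢ ⊗ xᵢ` is
killed by `α_M`, hence zero; its image in `W^s / KW` is the class of `x`, so `x ∈ KW`, which is the
required expansion. -/
theorem IsAlpha.hasLocalDualBases (h : IsAlpha κ) : HasLocalDualBases κ := by
  classical
  intro s
  let x : s → W := fun i => i
  let K : Submodule Rᵐᵒᵖ (s → R) := LinearMap.range (evalFamily κ x)
  let KW : AddSubgroup (s → W) :=
    AddSubgroup.closure {z : s → W | ∃ (v : V) (w : W), z = fun i => κ v (x i) • w}
  let f₀ : (s → R) →+ W →+ (s → W) ⧸ KW :=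
    AddMonoidHom.mk' (fun m => AddMonoidHom.mk'
      (fun w => QuotientAddGroup.mk (fun i => m i • w))
      (fun w w' => by rw [← QuotientAddGroup.mk_add]; congr 1; ext i; simp))
      (fun m m' => by
        ext w
        simp only [AddMonoidHom.mk'_apply, AddMonoidHom.add_apply]
        rw [← QuotientAddGroup.mk_add]; congr 1; ext i; simp [add_smul])
  have hf₀ : ∀ m ∈ K.toAddSubgroup, f₀ m = 0 := by
    rintro _ ⟨v, rfl⟩
    ext w
    exact (QuotientAddGroup.eq_zero_iff _).2 (AddSubgroup.subset_closure ⟨v, w, rfl⟩)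
  let f : ((s → R) ⧸ K) →+ W →+ (s → W) ⧸ KW := QuotientAddGroup.lift K.toAddSubgroup f₀ hf₀
  have hf : ∀ (m : s → R) (w : W), f (K.mkQ m) w = QuotientAddGroup.mk (fun i => m i • w) :=
    fun m w => rfl
  have hbal : ∀ (m : (s → R) ⧸ K) (r : R) (w : W),
      f (MulOpposite.op r • m) w = f m (r • w) := by
    intro m r w
    obtain ⟨m, rfl⟩ := K.mkQ_surjective m
    rw [← map_smul, hf, hf]
    congr 1
    ext i
    simp [mul_smul]
  let t : BalancedTensor R ((s → R) ⧸ K) W :=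
    ∑ i : s, BalancedTensor.tmul R (K.mkQ (Pi.single i 1)) (x i)
  have ht : t = 0 := by
    apply h ((s → R) ⧸ K)
    rw [map_zero]
    ext v
    have : alphaMap κ ((s → R) ⧸ K) t v = K.mkQ (evalFamily κ x v) := by
      simp only [t, map_sum, LinearMap.sum_apply, alphaMap_tmul]
      simp only [← map_smul, ← map_sum]
      congr 1
      ext i
      simp [evalFamily, Finset.sum_apply, Pi.single_apply]
    rw [this]
    exact (Submodule.Quotient.mk_eq_zero _).2 ⟨v, rfl⟩
  have h0 : BalancedTensor.lift f hbal t = QuotientAddGroup.mk (s := KW) x := by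
    simp only [t, map_sum, BalancedTensor.lift_tmul, hf]
    rw [← QuotientAddGroup.mk_sum]
    congr 1
    ext i
    simp [Finset.sum_apply, Pi.single_apply]
  rw [ht, map_zero] at h0
  obtain ⟨l, hl⟩ := exists_list_of_mem_closure ((QuotientAddGroup.eq_zero_iff _).1 h0.symm)
  exact ⟨l, fun w hw => hl ⟨w, hw⟩⟩

theorem isAlpha_iff : IsAlpha κ ↔ HasLocalDualBases κ :=
  ⟨IsAlpha.hasLocalDualBases, fun h M _ _ => h.alphaMap_injective M⟩

theorem HasLocalDualBases.chi_injective (h : HasLocalDualBases κ) :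
    Function.Injective (chi κ) := by
  rw [injective_iff_map_eq_zero]
  intro w hw
  obtain ⟨l, hl⟩ := h {w}
  have hv : ∀ v, κ v w = 0 := fun v => congrArg (fun g => g v) hw
  rw [hl w (by simp)]
  simp [hv]

theorem HasLocalDualBases.id (h : HasLocalDualBases κ) :
    HasLocalDualBases (LinearMap.id : (W →ₗ[R] R) →ₗ[Rᵐᵒᵖ] (W →ₗ[R] R)) := by
  intro s
  obtain ⟨l, hl⟩ := h s
  exact ⟨l.map fun p => (κ p.1, p.2), fun w hw => by simpa [Function.comp_def] using hl w hw⟩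

/-! ### Density and local projectivity -/

theorem isDense_iff (κ : V →ₗ[Rᵐᵒᵖ] (W →ₗ[R] R)) :
    IsDense κ ↔ ∀ (f : W →ₗ[R] R) (s : Finset W), ∃ v, ∀ w ∈ s, κ v w = f w := by
  let _ : TopologicalSpace R := ⊥
  have _ : DiscreteTopology R := ⟨rfl⟩
  let _ : TopologicalSpace (W →ₗ[R] R) := finiteTopology R W
  change Dense (Set.range κ) ↔ _
  have hind : Topology.IsInducing (fun f : W →ₗ[R] R => (f : W → R)) := ⟨rfl⟩
  constructor
  · intro h f s
    have hopen : IsOpen ((fun f : W →ₗ[R] R => (f : W → R)) ⁻¹'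
        (Set.pi (s : Set W) fun w => {f w})) :=
      (isOpen_set_pi s.finite_toSet fun w _ => isOpen_discrete _).preimage hind.continuous
    obtain ⟨_, hg, v, rfl⟩ := h.inter_open_nonempty _ hopen ⟨f, fun w _ => rfl⟩
    exact ⟨v, fun w hw => hg w hw⟩
  · intro h f
    rw [hind.closure_eq_preimage_closure_image, Set.mem_preimage, mem_closure_iff]
    intro o ho hfo
    obtain ⟨s, u, hu, hsub⟩ := isOpen_pi_iff.1 ho _ hfo
    obtain ⟨v, hv⟩ := h f s
    refine ⟨_, hsub fun w hw => ?_, κ v, ⟨v, rfl⟩, rfl⟩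
    change κ v w ∈ u w
    rw [hv w hw]
    exact (hu w hw).2

theorem hasLocalDualBases_of_isDense
    (h : HasLocalDualBases (LinearMap.id : (W →ₗ[R] R) →ₗ[Rᵐᵒᵖ] (W →ₗ[R] R)))
    (hd : IsDense κ) : HasLocalDualBases κ := by
  rw [isDense_iff] at hd
  intro s
  obtain ⟨l, hl⟩ := h s
  choose v hv using fun f => hd f s
  refine ⟨l.map fun p => (v p.1, p.2), fun w hw => ?_⟩
  conv_lhs => rw [hl w hw]
  simp [Function.comp_def, hv _ w hw]

/-- If the values of `f` on `s` are not those of some `v`, a right linear form `y ↦ ∑ rᵢ yᵢ`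
separates them from `K`. Vanishing on `K` says `χ (∑ rᵢ xᵢ) = 0`, so `∑ rᵢ xᵢ = 0`, and applying `f`
contradicts the separation. -/
theorem isDense_of_chi_injective (hR : IsCogenerator Rᵐᵒᵖ R) (h : Function.Injective (chi κ)) :
    IsDense κ := by
  classical
  rw [isDense_iff]
  intro f s
  let x : s → W := fun i => i
  let K : Submodule Rᵐᵒᵖ (s → R) := LinearMap.range (evalFamily κ x)
  suffices hK : (fun i => f (x i)) ∈ K by
    obtain ⟨v, hv⟩ := hK
    exact ⟨v, fun w hw => congrFun hv ⟨w, hw⟩⟩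
  by_contra hK
  obtain ⟨φ, hφ⟩ := hR ((s → R) ⧸ K) (K.mkQ fun i => f (x i))
    (fun h0 => hK ((Submodule.Quotient.mk_eq_zero _).1 h0))
  let r : s → R := fun i => φ (K.mkQ (Pi.single i 1))
  have hr : ∀ y : s → R, φ (K.mkQ y) = ∑ i, r i * y i := by
    intro y
    have hy : y = ∑ i, MulOpposite.op (y i) • (Pi.single i 1 : s → R) := by
      ext i; simp [Finset.sum_apply, Pi.single_apply]
    conv_lhs => rw [hy]
    simp only [map_sum, map_smul]
    rfl
  have hsum : ∑ i, r i • x i = 0 := by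
    apply h
    rw [map_zero]
    ext v
    have : φ (K.mkQ (evalFamily κ x v)) = 0 := by
      rw [show K.mkQ (evalFamily κ x v) = 0 from (Submodule.Quotient.mk_eq_zero _).2 ⟨v, rfl⟩,
        map_zero]
    rw [hr] at this
    simpa [chi, evalFamily] using this
  apply hφ
  rw [hr]
  simpa using congrArg f hsum

/-- Lifting the identity locally through the free module on `W` gives coordinate functionals;
conversely, a local dual basis lifts `g` by lifting each `g uⱼ`. -/
theorem isLocallyProjective_iff : IsLocallyProjective R W ↔
    HasLocalDualBases (LinearMap.id : (W →ₗ[R] R) →ₗ[Rᵐᵒᵖ] (W →ₗ[R] R)) := by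
  classical
  constructor
  · intro h s
    obtain ⟨g, hg⟩ := h (W →₀ R) W (Finsupp.linearCombination R id) LinearMap.id
      (Submodule.span R (s : Set W)) (Finsupp.linearCombination_surjective R Function.surjective_id)
      ⟨s, rfl⟩
    refine ⟨(s.biUnion fun w => (g w).support).toList.map
      fun u => ((Finsupp.lapply u).comp g, u), fun w hw => ?_⟩
    have := hg w (Submodule.subset_span hw)
    rw [LinearMap.id_apply, Finsupp.linearCombination_apply, Finsupp.sum_of_support_subset (g w)
      (Finset.subset_biUnion_of_mem (fun w => (g w).support) hw) _ (by simp),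
      ← Finset.sum_map_toList] at this
    simpa [Function.comp_def] using this.symm
  · rintro h L N _ _ _ _ π g F hπ ⟨s, rfl⟩
    obtain ⟨l, hl⟩ := h s
    choose σ hσ using hπ
    refine ⟨(l.map fun p => p.1.smulRight (σ (g p.2))).sum, fun x hx => ?_⟩
    rw [← LinearMap.comp_apply]
    refine LinearMap.eqOn_span (s := (s : Set W)) (fun w hw => ?_) hx
    conv_rhs => rw [hl w hw]
    clear hl
    induction l with
    | nil => simp
    | cons a l ih => simpa [hσ] using ih

/-! ### Purity -/

/-- The rows `(y a)_{y ∈ s}` span a right submodule of `R^s`, generated by finitely many rows; the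
coefficients of row `a` are the values at `a` of the new functions. -/
theorem exists_list_eq_sum_of_isNoetherian [IsNoetherian Rᵐᵒᵖ R] {X : Type*}
    (s : Finset (X → R)) :
    ∃ l : List (X × (X → R)), ∀ y ∈ s, y = (l.map fun p => y p.1 • p.2).sum := by
  classical
  let row : X → s → R := fun a y => y.1 a
  obtain ⟨t, hts, ht⟩ := (Submodule.fg_span_iff_fg_span_finset_subset (R := Rᵐᵒᵖ)
    (Set.range row)).1 (IsNoetherian.noetherian _)
  have hmem : ∀ a, ∃ c : (s → R) → Rᵐᵒᵖ, ∑ b ∈ t, c b • b = row a := fun a => by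
    have ha : row a ∈ Submodule.span Rᵐᵒᵖ (t : Set (s → R)) :=
      ht ▸ Submodule.subset_span ⟨a, rfl⟩
    obtain ⟨c, -, hc⟩ := Submodule.mem_span_finset.1 ha
    exact ⟨c, hc⟩
  choose c hc using hmem
  choose pt hpt using fun b : t => hts b.2
  refine ⟨t.attach.toList.map fun b => (pt b, fun a => (c a b).unop), fun y hy => ?_⟩
  ext a
  have h := congrFun (hc a) ⟨y, hy⟩
  rw [← Finset.sum_attach, Finset.sum_apply] at h
  rw [List.map_map, Function.comp_def, Finset.sum_map_toList, Finset.sum_apply]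
  refine h.symm.trans (Finset.sum_congr rfl fun b _ => ?_)
  rw [← hpt b]
  rfl

theorem IsAlpha.isPureEmbedding (h : IsAlpha κ) : IsPureEmbedding (chiFun κ) := by
  refine ⟨fun w w' hw => (isAlpha_iff.1 h).chi_injective
    (LinearMap.ext fun v => congrFun hw v), fun M _ _ => ?_⟩
  rw [injective_iff_map_eq_zero]
  intro t ht
  apply h M
  rw [map_zero]
  ext v
  let ev : M →+ (V → R) →+ M :=
    AddMonoidHom.mk' (fun m => AddMonoidHom.mk' (fun y => MulOpposite.op (y v) • m)
      (fun y y' => by simp [add_smul])) (fun m m' => by ext y; simp)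
  have hev : ∀ (m : M) (r : R) (y : V → R), ev (MulOpposite.op r • m) y = ev m (r • y) :=
    fun m r y => by simp [ev, mul_smul]
  have key : ∀ t : BalancedTensor R M W, alphaMap κ M t v =
      BalancedTensor.lift ev hev (BalancedTensor.lTensor M (chiFun κ) t) := by
    intro t
    induction t using BalancedTensor.induction_on with
    | zero => simp
    | tmul m w =>
      rw [alphaMap_tmul, BalancedTensor.lTensor_tmul, BalancedTensor.lift_tmul]
      rfl
    | add t₁ t₂ h₁ h₂ => simp [h₁, h₂]
  rw [key, ht, map_zero]
  rfl

theorem isAlpha_of_isPureEmbedding [IsNoetherian Rᵐᵒᵖ R] (h : IsPureEmbedding (chiFun κ)) :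
    IsAlpha κ := by
  classical
  intro M _ _
  rw [injective_iff_map_eq_zero]
  intro t ht
  apply h.2 M
  obtain ⟨s, hs⟩ := exists_finset_lTensor_eq κ (chiFun κ) t
  obtain ⟨l, hl⟩ := exists_list_eq_sum_of_isNoetherian (s.image (chiFun κ))
  rw [hs l fun w hw => hl _ (Finset.mem_image_of_mem _ hw), ht]
  simp [BalancedTensor.zero_tmul]

theorem isLocallyProjective_of_projective [Module.Projective R W] : IsLocallyProjective R W := by
  intro L N _ _ _ _ π g F hπ _
  obtain ⟨g', hg'⟩ := Module.projective_lifting_property π g hπ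
  exact ⟨g', fun x _ => LinearMap.congr_fun hg' x⟩

end

end LeftPairing

/-! ### Injective hulls of simple submodules -/

namespace Module

variable {A : Type u} [Ring A]

theorem exists_injective_embedding (S : Type u) [AddCommGroup S] [Module A S] :
    ∃ (E : Type u) (_ : AddCommGroup E) (_ : Module A E) (i : S →ₗ[A] E),
      Module.Injective A E ∧ Function.Injective i := by
  obtain ⟨⟨I, hI, f, hf⟩⟩ := CategoryTheory.EnoughInjectives.presentation (ModuleCat.of A S)
  exact ⟨I, inferInstance, inferInstance, f.hom,
    Module.injective_module_of_injective_object A I, (ModuleCat.mono_iff_injective _).1 hf⟩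

/-- A simple submodule of an injective module has an injective hull inside it, which is a direct
summand. -/
theorem exists_essential_retract {E : Type u} [AddCommGroup E] [Module A E] [Module.Injective A E]
    (S : Submodule A E) (hS : IsAtom S) :
    ∃ (N : Submodule A E) (p : E →ₗ[A] N), S ≤ N ∧
      (∀ x ∈ N, x ≠ 0 → S ≤ Submodule.span A {x}) ∧ ∀ x : N, p x = x := by
  obtain ⟨N, hSN, hN⟩ := zorn_le_nonempty₀
    {N : Submodule A E | ∀ x ∈ N, x ≠ 0 → S ≤ Submodule.span A {x}} (by
      intro c hc hchain y hy
      refine ⟨sSup c, fun x hx hx0 => ?_, fun z hz => le_sSup hz⟩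
      obtain ⟨N, hNc, hxN⟩ := (Submodule.mem_sSup_of_directed ⟨y, hy⟩ hchain.directedOn).1 hx
      exact hc hNc x hxN hx0) S (by
      intro x hx hx0
      have hle : Submodule.span A {x} ≤ S := by simpa using hx
      exact ((hS.le_iff_eq (by simpa using hx0)).1 hle).ge)
  -- `N` is a maximal essential extension of `S` in `E`. With `K` a maximal complement of `S`, the
  -- image of `S` is essential in `E / K`.
  obtain ⟨K, -, hK⟩ := zorn_le_nonempty₀ {K : Submodule A E | Disjoint S K} (by
      intro c hc hchain y hy
      refine ⟨sSup c, ?_, fun z hz => le_sSup hz⟩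
      rw [Set.mem_ofPred_eq, Submodule.disjoint_def]
      intro x hxS hx
      obtain ⟨K, hKc, hxK⟩ := (Submodule.mem_sSup_of_directed ⟨y, hy⟩ hchain.directedOn).1 hx
      exact Submodule.disjoint_def.1 (hc hKc) x hxS hxK) ⊥ disjoint_bot_right
  have hess := hN.prop
  rw [Set.mem_ofPred_eq] at hess
  have hdisj : Disjoint S K := hK.prop
  have hlarge : ∀ x ∉ K, ∃ k ∈ K, ∃ a : A, k + a • x ∈ S ∧ k + a • x ≠ 0 := by
    intro x hx
    have : ¬ Disjoint S (K ⊔ Submodule.span A {x}) := fun h =>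
      hx (hK.le_of_ge h le_sup_left (Submodule.mem_sup_right (Submodule.mem_span_singleton_self x)))
    rw [Submodule.disjoint_def] at this
    push Not at this
    obtain ⟨y, hyS, hy, hy0⟩ := this
    obtain ⟨k, hk, b, hb, rfl⟩ := Submodule.mem_sup.1 hy
    obtain ⟨a, rfl⟩ := Submodule.mem_span_singleton.1 hb
    exact ⟨k, hk, a, hyS, hy0⟩
  have hinj : Function.Injective (K.mkQ.comp N.subtype) := by
    rw [injective_iff_map_eq_zero]
    intro x hx
    by_contra hx0
    have hxK : (x : E) ∈ K := (Submodule.Quotient.mk_eq_zero _).1 hx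
    have hle : S ≤ K := (hess x x.2 (by simpa using hx0)).trans (by simpa using hxK)
    exact hS.1 (disjoint_self.1 (hdisj.mono_right hle))
  obtain ⟨h, hh⟩ := Module.Injective.out (K.mkQ.comp N.subtype) hinj N.subtype
  -- The range of `h` contains `N` and is still essential over `S`, so maximality of `N` applies.
  have hrange : LinearMap.range h ≤ N := by
    refine hN.le_of_ge ?_ (fun x hx => ⟨_, hh ⟨x, hx⟩⟩)
    rintro _ ⟨x, rfl⟩ hx0
    obtain ⟨x, rfl⟩ := K.mkQ_surjective x
    have hxK : x ∉ K := fun hxK => hx0 (by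
      rw [show K.mkQ x = 0 from (Submodule.Quotient.mk_eq_zero _).2 hxK, map_zero])
    obtain ⟨k, hk, a, haS, ha0⟩ := hlarge x hxK
    have hval := hh ⟨k + a • x, hSN haS⟩
    have hmem : k + a • x ∈ Submodule.span A {h (K.mkQ x)} := by
      refine Submodule.mem_span_singleton.2 ⟨a, ?_⟩
      rw [← map_smul, ← map_smul]
      refine Eq.trans ?_ hval
      simp only [LinearMap.comp_apply, Submodule.subtype_apply, map_add]
      rw [show K.mkQ k = 0 from (Submodule.Quotient.mk_eq_zero _).2 hk, map_zero, zero_add]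
    refine ((hS.le_iff_eq (b := Submodule.span A {k + a • x}) (by simpa using ha0)).1
      (by simpa using haS)).ge.trans (by simpa using hmem)
  refine ⟨N, (h.comp K.mkQ).codRestrict N fun x => hrange ⟨_, rfl⟩, hSN, hess, fun x => ?_⟩
  exact Subtype.ext (hh x)

end Module

/-! ### Left Noetherian left cogenerator rings -/

section Cogenerator

variable {A : Type u} [Ring A]

/-- An idempotent `e ≠ 0` such that `e A e` is a local ring. -/
structure IsLocalIdempotent (e : A) : Prop where
  mul_self : e * e = e
  ne_zero : e ≠ 0
  unit_or : ∀ a, e * a = a → a * e = a →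
    (∃ b, a * b = e ∧ b * a = e) ∨ ∃ b, (e - a) * b = e ∧ b * (e - a) = e

/-- Since `e - a` kills `t ≠ 0`, it cannot be invertible in `e A e`. -/
theorem IsLocalIdempotent.exists_inverse {e : A} (he : IsLocalIdempotent e) {a : A}
    (hea : e * a = a) (hae : a * e = a) {T : Type*} [AddCommGroup T] [Module A T] {t : T}
    (ht : t ≠ 0) (het : e • t = t) (hat : a • t = t) : ∃ b, a * b = e ∧ b * a = e := by
  refine (he.unit_or a hea hae).resolve_right ?_
  rintro ⟨b, -, hb⟩
  apply ht
  rw [← het, ← hb, mul_smul, sub_smul, het, hat, sub_self, smul_zero]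

theorem exists_smul_eq_of_isSimpleModule {T : Type*} [AddCommGroup T] [Module A T]
    [IsSimpleModule A T] {t : T} (ht : t ≠ 0) (t' : T) : ∃ a : A, a • t = t' :=
  IsSimpleModule.toSpanSingleton_surjective A ht t'

theorem IsLocalIdempotent.exists_mul_eq {e : A} (he : IsLocalIdempotent e) {x : A}
    (hx : e * x = x) (hxJ : x ∉ Ring.jacobson A) : ∃ y, x * y = e := by
  rw [Ring.jacobson_eq_sInf_isMaximal, Submodule.mem_sInf] at hxJ
  push Not at hxJ
  obtain ⟨m, hm, hxm⟩ := hxJ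
  replace hm : Ideal.IsMaximal m := hm
  have : IsSimpleModule A (A ⧸ m) := isSimpleModule_iff_isCoatom.2 hm.out
  have ht : (m.mkQ x) ≠ 0 := fun h => hxm ((Submodule.Quotient.mk_eq_zero _).1 h)
  obtain ⟨z, hz⟩ := exists_smul_eq_of_isSimpleModule (A := A) ht (m.mkQ 1)
  have hxe : e • m.mkQ x = m.mkQ x := by rw [← map_smul, smul_eq_mul, hx]
  obtain ⟨b, hb, -⟩ := he.exists_inverse (a := x * z * e) (t := m.mkQ x)
    (by rw [← mul_assoc, ← mul_assoc, hx]) (by rw [mul_assoc, he.mul_self]) ht hxe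
    (by rw [mul_smul, mul_smul, hxe, hz, ← map_smul, smul_eq_mul, mul_one])
  exact ⟨z * e * b, by simpa only [mul_assoc] using hb⟩

theorem IsLocalIdempotent.exists_simple {e : A} (he : IsLocalIdempotent e) :
    ∃ (T : Type u) (_ : AddCommGroup T) (_ : Module A T), IsSimpleModule A T ∧
      ∃ t : T, e • t ≠ 0 := by
  have hne : Ideal.span {1 - e} ≠ ⊤ := by
    rw [Ne, Ideal.eq_top_iff_one, Ideal.mem_span_singleton']
    rintro ⟨c, hc⟩
    apply he.ne_zero
    rw [← one_mul e, ← hc, mul_assoc, sub_mul, one_mul, he.mul_self, sub_self, mul_zero]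
  obtain ⟨m, hm, hle⟩ := Ideal.exists_le_maximal _ hne
  refine ⟨A ⧸ m, inferInstance, inferInstance, isSimpleModule_iff_isCoatom.2 hm.out,
    m.mkQ 1, fun h => ?_⟩
  rw [← map_smul, smul_eq_mul, mul_one] at h
  apply hm.ne_top
  rw [Ideal.eq_top_iff_one, ← sub_add_cancel 1 e]
  exact m.add_mem (hle (Ideal.mem_span_singleton_self _)) ((Submodule.Quotient.mk_eq_zero _).1 h)

theorem exists_embedding_of_isCogenerator (hA : IsCogenerator A A) (S : Type u) [AddCommGroup S]
    [Module A S] [IsSimpleModule A S] : ∃ φ : S →ₗ[A] A, Function.Injective φ := by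
  have := IsSimpleModule.nontrivial A S
  obtain ⟨s, hs⟩ := exists_ne (0 : S)
  obtain ⟨φ, hφ⟩ := hA S s hs
  exact ⟨φ, (LinearMap.injective_or_eq_zero φ).resolve_right fun h => hφ (by simp [h])⟩

/-- Over a left cogenerator ring, the injective hull of a simple module `S` is isomorphic to
`A e` for a local idempotent `e`. -/
theorem exists_localIdempotent_socle (hA : IsCogenerator A A) (S : Type u) [AddCommGroup S]
    [Module A S] [IsSimpleModule A S] :
    ∃ (e : A) (φ : S →ₗ[A] A) (s : S), IsLocalIdempotent e ∧ φ s ≠ 0 ∧ φ s * e = φ s ∧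
      ∀ x, x * e = x → x ≠ 0 → ∃ c, c * x = φ s := by
  obtain ⟨E, _, _, i, hE, hi⟩ := Module.exists_injective_embedding (A := A) S
  have := IsSimpleModule.nontrivial A S
  obtain ⟨s, hs⟩ := exists_ne (0 : S)
  have hatom : IsAtom (LinearMap.range i) := by
    rw [← isSimpleModule_iff_isAtom]
    exact IsSimpleModule.congr (LinearEquiv.ofInjective i hi).symm
  obtain ⟨N, p, hSN, hess, hp⟩ := Module.exists_essential_retract _ hatom
  obtain ⟨f₀, hf₀⟩ := hA E (i s) fun h => hs (hi (h.trans i.map_zero.symm))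
  let f : N →ₗ[A] A := f₀.comp N.subtype
  have hsoc : ∀ n : N, n ≠ 0 → ∃ c : A, c * f n = f₀ (i s) := by
    intro n hn
    obtain ⟨c, hc⟩ := Submodule.mem_span_singleton.1
      (hess n n.2 (by simpa using hn) ⟨s, rfl⟩)
    exact ⟨c, by rw [← hc, map_smul]; rfl⟩
  -- Right multiplication by `b` is injective on `f N`, since a nonzero kernel would contain the
  -- socle; injectivity of `E` then gives a left inverse.
  have hext : ∀ b : A, f₀ (i s) * b ≠ 0 → ∃ q : A →ₗ[A] N, ∀ n, q (f n * b) = n := by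
    intro b hb
    obtain ⟨g, hg⟩ := Module.Injective.out ((LinearMap.toSpanSingleton A A b).comp f) (by
      rw [injective_iff_map_eq_zero]
      intro n hn
      by_contra hn0
      obtain ⟨c, hc⟩ := hsoc n hn0
      have hn' : f n * b = 0 := hn
      exact hb (by rw [← hc, mul_assoc, hn', mul_zero])) N.subtype
    exact ⟨p.comp g, fun n => by
      have : g (f n * b) = n := hg n
      rw [LinearMap.comp_apply, this, hp]⟩
  obtain ⟨q, hq⟩ := hext 1 (by rwa [mul_one])
  simp only [mul_one] at hq
  have hmul : ∀ (q' : A →ₗ[A] N) (a : A), a * f (q' 1) = f (q' a) := by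
    intro q' a
    rw [← smul_eq_mul, ← map_smul, ← map_smul, smul_eq_mul, mul_one]
  obtain ⟨e, he⟩ : ∃ e, e = f (q 1) := ⟨_, rfl⟩
  have hfe : ∀ n, f n * e = f n := fun n => by rw [he, hmul, hq]
  have hee : e * e = e := by conv_lhs => rw [he, ← he, he, hmul, hq]
                             exact he.symm
  have hz : f₀ (i s) * e = f₀ (i s) := hfe ⟨i s, hSN ⟨s, rfl⟩⟩
  have hsoc' : ∀ x, x * e = x → x ≠ 0 → ∃ c, c * x = f₀ (i s) := by
    intro x hx hx0
    rw [he, hmul] at hx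
    obtain ⟨c, hc⟩ := hsoc (q x) fun h => hx0 (by rw [← hx, h, map_zero])
    exact ⟨c, by rw [← hc, hx]⟩
  have hunit : ∀ b, e * b = b → b * e = b → f₀ (i s) * b ≠ 0 →
      ∃ d, b * d = e ∧ d * b = e := by
    intro b heb hbe hzb
    obtain ⟨q', hq'⟩ := hext b hzb
    obtain ⟨d, hd⟩ : ∃ d, d = e * f (q' 1) := ⟨_, rfl⟩
    have hbd : b * d = e := by
      rw [hd, ← mul_assoc, hbe, hmul]
      conv_lhs => rw [← heb, he, hq']
      exact he.symm
    refine ⟨d, hbd, ?_⟩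
    have hed : e * d = d := by rw [hd, ← mul_assoc, hee]
    -- If the idempotent `d * b` differed from `e`, the socle would lie in both `A (d b)` and `A (e
    -- - d b)`.
    have huu : d * b * (d * b) = d * b := by
      rw [mul_assoc, ← mul_assoc b, hbd, heb]
    have hue : d * b * e = d * b := by rw [mul_assoc, hbe]
    have heu : e * (d * b) = d * b := by rw [← mul_assoc, hed]
    have hu0 : d * b ≠ 0 := by
      intro h
      apply hzb
      rw [← heb, ← hbd, mul_assoc b, h, mul_zero, mul_zero]
    by_contra hne
    obtain ⟨c, hc⟩ := hsoc' _ hue hu0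
    obtain ⟨c', hc'⟩ := hsoc' (e - d * b) (by rw [sub_mul, hee, hue])
      (fun h => hne (sub_eq_zero.1 h).symm)
    have h1 : f₀ (i s) * (d * b) = f₀ (i s) := by rw [← hc, mul_assoc, huu]
    have h2 : f₀ (i s) * (d * b) = 0 := by
      rw [← hc', mul_assoc, sub_mul, heu, huu, sub_self, mul_zero]
    exact hf₀ (h1.symm.trans h2)
  refine ⟨e, f₀.comp i, s, ⟨hee, ?_, ?_⟩, hf₀, hz, hsoc'⟩
  · intro h
    rw [h, mul_zero] at hz
    exact hf₀ hz.symm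
  · intro a hea hae
    by_cases h : f₀ (i s) * a = 0
    · exact Or.inr (hunit (e - a) (by rw [mul_sub, hee, hea]) (by rw [sub_mul, hee, hae])
        (by rwa [mul_sub, hz, h, sub_zero]))
    · exact Or.inl (hunit a hea hae h)

/-- Going from `e t` to `e' t'` and back gives an element of `e A e` fixing `e t`, hence invertible
there. So its first factor `c` embeds `A e` into `A e'`. -/
theorem exists_intertwiner {e e' : A} (he : IsLocalIdempotent e) (he' : IsLocalIdempotent e')
    {T : Type*} [AddCommGroup T] [Module A T] [IsSimpleModule A T] {t t' : T} (ht : e • t ≠ 0)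
    (ht' : e' • t' ≠ 0) : ∃ c, c * e' = c ∧ ∀ x, x * e = x → x * c = 0 → x = 0 := by
  obtain ⟨a, ha⟩ := exists_smul_eq_of_isSimpleModule (A := A) ht (e' • t')
  obtain ⟨a', ha'⟩ := exists_smul_eq_of_isSimpleModule (A := A) ht' (e • t)
  have hidem : e • e • t = e • t := by rw [← mul_smul, he.mul_self]
  have hidem' : e' • e' • t' = e' • t' := by rw [← mul_smul, he'.mul_self]
  obtain ⟨b, hb, -⟩ := he.exists_inverse (a := e * a' * e' * a * e) (t := e • t)
    (by simp only [← mul_assoc, he.mul_self]) (by simp only [mul_assoc, he.mul_self]) ht hidem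
    (by simp only [mul_smul]; rw [hidem, ha, hidem', ha', hidem])
  refine ⟨e * a' * e', by rw [mul_assoc, he'.mul_self], fun x hx hx0 => ?_⟩
  rw [← hx, ← hb, mul_assoc (e * a' * e') a, mul_assoc (e * a' * e'), ← mul_assoc x, hx0, zero_mul]

/-- A simple module over a left Noetherian left cogenerator ring is not annihilated by all local
idempotents. -/
theorem exists_localIdempotent_smul_ne_zero [IsNoetherianRing A] (hA : IsCogenerator A A)
    (T : Type u) [AddCommGroup T] [Module A T] [IsSimpleModule A T] :
    ∃ e : A, IsLocalIdempotent e ∧ ∃ t : T, e • t ≠ 0 := by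
  have hcomp : ∀ {S S' : Submodule A A} [IsSimpleModule A S] [IsSimpleModule A S'],
      isotypicComponent A A S = isotypicComponent A A S' → Nonempty (S ≃ₗ[A] S') := by
    intro S S' _ _ h
    have hle : S ≤ sSup {m : Submodule A A | Nonempty (m ≃ₗ[A] S')} :=
      S.le_isotypicComponent.trans h.le
    have : ∀ m : {m : Submodule A A | Nonempty (m ≃ₗ[A] S')}, IsSimpleModule A m :=
      fun m => IsSimpleModule.congr m.2.some
    obtain ⟨m, ⟨e'⟩, ⟨e⟩⟩ := S.linearEquiv_of_le_sSup _ hle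
    exact ⟨e.trans e'⟩
  have hsub : ∀ (T : Type u) [AddCommGroup T] [Module A T] [IsSimpleModule A T],
      ∃ S : Submodule A A, IsSimpleModule A S ∧ Nonempty (T ≃ₗ[A] S) := by
    intro T _ _ _
    obtain ⟨φ, hφ⟩ := exists_embedding_of_isCogenerator hA T
    exact ⟨_, IsSimpleModule.congr (LinearEquiv.ofInjective φ hφ).symm,
      ⟨LinearEquiv.ofInjective φ hφ⟩⟩
  choose S hS hSc using fun c : isotypicComponents A A => c.2
  choose e φ s he hφs hφe hsoc using fun c => exists_localIdempotent_socle hA (S c)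
  have htop : ∀ c, ∃ T : Submodule A A, IsSimpleModule A T ∧ ∃ t : T, e c • t ≠ 0 := by
    intro c
    obtain ⟨T, _, _, _, t, ht⟩ := (he c).exists_simple
    obtain ⟨T', hT', ⟨ε⟩⟩ := hsub T
    exact ⟨T', hT', ε t, by rwa [← map_smul, Ne, ε.map_eq_zero_iff]⟩
  choose top htop t ht using htop
  -- `F` sends the socle type of `A e` to its top type. Equal tops give an embedding `A e → A e'`,
  -- so the essential socles agree.
  let F : isotypicComponents A A → isotypicComponents A A :=
    fun c => ⟨isotypicComponent A A (top c), top c, htop c, rfl⟩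
  have hF : Function.Injective F := by
    intro c c' h
    obtain ⟨ε⟩ := hcomp (congrArg Subtype.val h)
    obtain ⟨a, hae, ha⟩ := exists_intertwiner (he c) (he c') (T := top c') (t := ε (t c))
      (by rw [← map_smul, Ne, ε.map_eq_zero_iff]; exact ht c) (ht c')
    let ψ : S c →ₗ[A] A := (LinearMap.toSpanSingleton A A a).comp (φ c)
    have hψs : ψ (s c) ≠ 0 := fun h0 => hφs c (ha _ (hφe c) h0)
    have hψ : Function.Injective ψ :=
      (LinearMap.injective_or_eq_zero ψ).resolve_right fun h0 => hψs (by simp [h0])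
    have hφ' : Function.Injective (φ c') :=
      (LinearMap.injective_or_eq_zero (φ c')).resolve_right fun h0 => hφs c' (by simp [h0])
    obtain ⟨d, hd⟩ := hsoc c' (ψ (s c)) (by
      change φ c (s c) * a * e c' = φ c (s c) * a
      rw [mul_assoc, hae]) hψs
    have h₁ : IsAtom (LinearMap.range ψ) := by
      rw [← isSimpleModule_iff_isAtom]
      exact IsSimpleModule.congr (LinearEquiv.ofInjective ψ hψ).symm
    have h₂ : IsAtom (LinearMap.range (φ c')) := by
      rw [← isSimpleModule_iff_isAtom]
      exact IsSimpleModule.congr (LinearEquiv.ofInjective (φ c') hφ').symm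
    have heq : LinearMap.range ψ = LinearMap.range (φ c') := by
      by_contra hne
      have := (h₁.disjoint_of_ne h₂ hne)
      exact hφs c' (Submodule.disjoint_def.1 this _ ⟨d • s c, by rw [map_smul]; exact hd⟩ ⟨_, rfl⟩)
    have ε' : S c ≃ₗ[A] S c' := (LinearEquiv.ofInjective ψ hψ).trans
      ((LinearEquiv.ofEq _ _ heq).trans (LinearEquiv.ofInjective (φ c') hφ').symm)
    apply Subtype.ext
    rw [hSc c, hSc c']
    exact ε'.isotypicComponent_eq
  obtain ⟨T', hT', ⟨ε⟩⟩ := hsub T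
  obtain ⟨c, hc⟩ := (Finite.injective_iff_surjective.1 hF) ⟨isotypicComponent A A T', T', hT', rfl⟩
  obtain ⟨ε'⟩ := hcomp (congrArg Subtype.val hc)
  exact ⟨e c, he c, ε.symm (ε' (t c)), by
    rw [← map_smul, ← map_smul, Ne, ε.symm.map_eq_zero_iff, ε'.map_eq_zero_iff]; exact ht c⟩

theorem eq_top_of_localIdempotent_mul_mem [IsNoetherianRing A] (hA : IsCogenerator A A)
    {I : Ideal A} (hI : ∀ e, IsLocalIdempotent e → ∀ b, e * b ∈ I) : I = ⊤ := by
  by_contra hne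
  obtain ⟨m, hm, hle⟩ := Ideal.exists_le_maximal _ hne
  have : IsSimpleModule A (A ⧸ m) := isSimpleModule_iff_isCoatom.2 hm.out
  obtain ⟨e, he, t, ht⟩ := exists_localIdempotent_smul_ne_zero hA (A ⧸ m)
  obtain ⟨b, rfl⟩ := m.mkQ_surjective t
  apply ht
  rw [← map_smul]
  exact (Submodule.Quotient.mk_eq_zero _).2 (hle (hI e he b))

/-- Maps `A / I → A` are right multiplications by elements that `I` annihilates from the left. -/
theorem exists_annihilating_of_notMem (hA : IsCogenerator A A) {I : Ideal A} {a : A} (ha : a ∉ I) :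
    ∃ x, (∀ i ∈ I, i * x = 0) ∧ a * x ≠ 0 := by
  obtain ⟨φ, hφ⟩ := hA (A ⧸ I) (I.mkQ a) fun h => ha ((Submodule.Quotient.mk_eq_zero _).1 h)
  have h : ∀ b, b * φ (I.mkQ 1) = φ (I.mkQ b) := fun b => by
    rw [← smul_eq_mul, ← map_smul, ← map_smul, smul_eq_mul, mul_one]
  refine ⟨φ (I.mkQ 1), fun i hi => ?_, by rwa [h]⟩
  rw [h, show I.mkQ i = 0 from (Submodule.Quotient.mk_eq_zero _).2 hi, map_zero]

/-- The right annihilators of the powers of the radical stabilize, so by double annihilators the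
powers do too; Nakayama's lemma finishes. -/
theorem exists_jacobson_pow_eq_bot [IsNoetherianRing A] (hA : IsCogenerator A A) :
    ∃ n, Ring.jacobson A ^ n = ⊥ := by
  let r : ℕ →o Submodule A A :=
    { toFun n :=
        { carrier := {x | ∀ j ∈ Ring.jacobson A ^ n, j * x = 0}
          add_mem' hx hy j hj := by rw [mul_add, hx j hj, hy j hj, add_zero]
          zero_mem' j _ := mul_zero j
          smul_mem' a x hx j hj := by
            rw [smul_eq_mul, ← mul_assoc]
            exact hx _ (Ideal.mul_mem_right a _ hj) }
      monotone' m n hmn x hx j hj := hx j (Ideal.pow_le_pow_right hmn hj) }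
  obtain ⟨n, hn⟩ := monotone_stabilizes_iff_noetherian.2 ‹IsNoetherianRing A› r
  refine ⟨n, Submodule.FG.eq_bot_of_le_jacobson_smul (IsNoetherian.noetherian _) ?_⟩
  intro a ha
  by_contra hna
  rw [smul_eq_mul, ← Ideal.IsTwoSided.pow_succ] at hna
  obtain ⟨x, hx, hax⟩ := exists_annihilating_of_notMem hA hna
  have hxr : x ∈ r (n + 1) := hx
  rw [← hn (n + 1) (Nat.le_succ n)] at hxr
  exact hax (hxr a ha)

end Cogenerator

/-! ### Locally projective modules over semiprimary rings -/

section LocallyProjective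

variable {R : Type u} [Ring R]

/-- A nilpotent ideal `J` and a set `E` of idempotents which presents `R` as a semiprimary ring:
for `e ∈ E` every element of `R e` outside `J` generates `R e`, and no nonzero module is annihilated
by `E`. -/
structure IsSemiprimarySystem (J : Ideal R) (E : Set R) : Prop where
  isTwoSided : J.IsTwoSided
  exists_pow_eq_bot : ∃ n, J ^ n = ⊥
  mul_self : ∀ e ∈ E, e * e = e
  exists_mul_eq : ∀ e ∈ E, ∀ x, x * e = x → x ∉ J → ∃ y, y * x = e
  exists_smul_ne_zero : ∀ (T : Type u) [AddCommGroup T] [Module R T] [Nontrivial T],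
    ∃ e ∈ E, ∃ t : T, e • t ≠ 0

theorem IsCogenerator.congr {S U U' : Type u} [Ring S] [AddCommGroup U] [Module S U]
    [AddCommGroup U'] [Module S U'] (ε : U ≃ₗ[S] U') (h : IsCogenerator S U) :
    IsCogenerator S U' := by
  intro N _ _ n hn
  obtain ⟨f, hf⟩ := h N n hn
  exact ⟨ε.toLinearMap.comp f, by simpa using hf⟩

theorem IsQFRing.exists_isSemiprimarySystem (hR : IsQFRing R) :
    ∃ (J : Ideal R) (E : Set R), IsSemiprimarySystem J E := by
  let ε : R ≃ₗ[Rᵐᵒᵖ] Rᵐᵒᵖ :=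
    { MulOpposite.opAddEquiv with map_smul' := fun r x => rfl }
  have hA : IsCogenerator Rᵐᵒᵖ Rᵐᵒᵖ := hR.2.congr ε
  have : IsNoetherianRing Rᵐᵒᵖ := by
    have := hR.1
    exact isNoetherian_of_linearEquiv ε
  let J : Ideal R :=
    { carrier := {x | MulOpposite.op x ∈ Ring.jacobson Rᵐᵒᵖ}
      add_mem' := fun {x y} hx hy => by
        simpa using (Ring.jacobson Rᵐᵒᵖ).add_mem hx hy
      zero_mem' := (Ring.jacobson Rᵐᵒᵖ).zero_mem
      smul_mem' := fun a x hx => (Ring.jacobson Rᵐᵒᵖ).mul_mem_right (MulOpposite.op a) hx }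
  have hJ : ∀ n, ∀ x ∈ J ^ n, MulOpposite.op x ∈ Ring.jacobson Rᵐᵒᵖ ^ n := by
    intro n
    induction n with
    | zero => intro x _; rw [Submodule.pow_zero, Ideal.one_eq_top]; trivial
    | succ n ih =>
      intro x hx
      rw [Submodule.pow_succ] at hx
      rw [Ideal.IsTwoSided.pow_succ]
      induction hx using Submodule.mul_induction_on' with
      | mem_mul_mem a ha b hb => exact Ideal.mul_mem_mul hb (ih a ha)
      | add x _ y _ hx hy => rw [MulOpposite.op_add]; exact Ideal.add_mem _ hx hy
  refine ⟨J, {e | IsLocalIdempotent (MulOpposite.op e)}, ⟨⟨?_⟩, ?_, ?_, ?_, ?_⟩⟩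
  · intro a b ha
    exact (Ring.jacobson Rᵐᵒᵖ).mul_mem_left (MulOpposite.op b) ha
  · obtain ⟨n, hn⟩ := exists_jacobson_pow_eq_bot hA
    refine ⟨n, (Submodule.eq_bot_iff _).2 fun x hx => ?_⟩
    have := hJ n x hx
    rw [hn] at this
    exact MulOpposite.op_injective ((Submodule.mem_bot _).1 this)
  · intro e he
    exact MulOpposite.op_injective he.mul_self
  · intro e he x hx hxJ
    obtain ⟨y, hy⟩ := he.exists_mul_eq (x := MulOpposite.op x)
      (congrArg MulOpposite.op hx) hxJ
    exact ⟨y.unop, congrArg MulOpposite.unop hy⟩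
  · intro T _ _ _
    by_contra! h
    let I : Ideal Rᵐᵒᵖ :=
      { carrier := {a | ∀ t : T, a.unop • t = 0}
        add_mem' := fun {a b} ha hb t => by
          rw [MulOpposite.unop_add, add_smul, ha t, hb t, add_zero]
        zero_mem' := fun t => by simp
        smul_mem' := fun a b hb t => by
          rw [smul_eq_mul, MulOpposite.unop_mul, mul_smul, hb] }
    have hI : I = ⊤ := eq_top_of_localIdempotent_mul_mem hA fun e he b t => by
      rw [MulOpposite.unop_mul, mul_smul, h e.unop he, smul_zero]
    have h1 : (1 : Rᵐᵒᵖ) ∈ I := hI ▸ Submodule.mem_top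
    obtain ⟨t, ht⟩ := exists_ne (0 : T)
    exact ht (by simpa using h1 t)

variable {J : Ideal R} {E : Set R}

theorem IsSemiprimarySystem.isAtom_span (h : IsSemiprimarySystem J E) {Q : Type*} [AddCommGroup Q]
    [Module R Q] (hQ : ∀ j ∈ J, ∀ q : Q, j • q = 0) {e : R} (he : e ∈ E) {q : Q} (heq : e • q = q)
    (hq : q ≠ 0) : IsAtom (Submodule.span R {q}) := by
  refine ⟨by simpa using hq, fun N hN => ?_⟩
  by_contra hN0
  obtain ⟨n, hn, hn0⟩ := Submodule.exists_mem_ne_zero_of_ne_bot hN0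
  obtain ⟨x, rfl⟩ := Submodule.mem_span_singleton.1 (hN.le hn)
  have hxe : (x * e) • q = x • q := by rw [mul_smul, heq]
  obtain ⟨y, hy⟩ := h.exists_mul_eq e he (x * e) (by rw [mul_assoc, h.mul_self e he])
    (fun hx => hn0 (by rw [← hxe, hQ _ hx]))
  refine hN.not_ge ?_
  rw [Submodule.span_singleton_le_iff_mem, ← heq, ← hy, mul_smul, hxe]
  exact N.smul_mem y hn

/-- Were the quotient by the socle nonzero, some `e • q` would survive in it, yet `e • q` spans an
atom. -/
theorem IsSemiprimarySystem.sSup_atoms_eq_top (h : IsSemiprimarySystem J E) {Q : Type u}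
    [AddCommGroup Q] [Module R Q] (hQ : ∀ j ∈ J, ∀ q : Q, j • q = 0) :
    sSup {N : Submodule R Q | IsAtom N} = ⊤ := by
  by_contra hne
  have : Nontrivial (Q ⧸ sSup {N : Submodule R Q | IsAtom N}) :=
    Submodule.Quotient.nontrivial_iff.2 hne
  obtain ⟨e, he, t, ht⟩ := h.exists_smul_ne_zero (Q ⧸ sSup {N : Submodule R Q | IsAtom N})
  obtain ⟨q, rfl⟩ := Submodule.mkQ_surjective _ t
  rw [← map_smul] at ht
  apply ht
  refine (Submodule.Quotient.mk_eq_zero _).2 ?_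
  have hatom := h.isAtom_span hQ he (q := e • q) (by rw [← mul_smul, h.mul_self e he])
    (fun h0 => ht (by rw [h0, map_zero]))
  exact le_sSup (a := Submodule.span R {e • q}) hatom (Submodule.mem_span_singleton_self _)

theorem Submodule.eq_top_of_sup_smul_top_eq_top {W : Type*} [AddCommGroup W] [Module R W] {n : ℕ}
    (hJ : J ^ n = ⊥) {N : Submodule R W} (hN : N ⊔ J • ⊤ = ⊤) : N = ⊤ := by
  have key : ∀ k, N ⊔ J ^ k • (⊤ : Submodule R W) = ⊤ := by
    intro k
    induction k with
    | zero => rw [Submodule.pow_zero, Ideal.one_eq_top, Submodule.top_smul, sup_top_eq]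
    | succ k ih =>
      refine eq_top_iff.2 (ih.ge.trans (sup_le le_sup_left ?_))
      have hpow : J ^ (k + 1) • (⊤ : Submodule R W) = J ^ k • J • ⊤ := by
        rw [Submodule.pow_succ]
        exact Submodule.smul_assoc (J ^ k) J ⊤
      have hsup : J ^ k • (⊤ : Submodule R W) = J ^ k • N ⊔ J ^ k • J • ⊤ := by
        rw [← Submodule.smul_sup, hN]
      rw [hpow, hsup]
      exact sup_le_sup_right (Submodule.smul_le_right (I := J ^ k) (N := N)) _
  have := key n
  rwa [hJ, Submodule.bot_smul, sup_bot_eq] at this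

theorem IsSemiprimarySystem.projective (h : IsSemiprimarySystem J E) {W : Type u} [AddCommGroup W]
    [Module R W] (hW : IsLocallyProjective R W) : Module.Projective R W := by
  classical
  have := h.isTwoSided
  obtain ⟨n, hn⟩ := h.exists_pow_eq_bot
  let JW : Submodule R W := J • ⊤
  have hQ : ∀ j ∈ J, ∀ q : W ⧸ JW, j • q = 0 := by
    intro j hj q
    obtain ⟨w, rfl⟩ := JW.mkQ_surjective q
    rw [← map_smul]
    exact (Submodule.Quotient.mk_eq_zero _).2 (Submodule.smul_mem_smul hj trivial)
  obtain ⟨s, hind, hs, hatom⟩ := exists_sSupIndep_of_sSup_atoms_eq_top (h.sSup_atoms_eq_top hQ)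
  have hgen : ∀ T : s, ∃ e ∈ E, ∃ w : W, e • w = w ∧ JW.mkQ w ∈ T.1 ∧ JW.mkQ w ≠ 0 := by
    intro T
    have : Nontrivial T.1 := Submodule.nontrivial_iff_ne_bot.2 (hatom T.2).1
    obtain ⟨e, he, t, ht⟩ := h.exists_smul_ne_zero T.1
    obtain ⟨w, hw⟩ := JW.mkQ_surjective t
    refine ⟨e, he, e • w, by rw [← mul_smul, h.mul_self e he], ?_, ?_⟩
    · rw [map_smul, hw]
      exact T.1.smul_mem e t.2
    · rw [map_smul, hw]
      exact fun h0 => ht (Subtype.ext h0)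
  choose e he w hew hwT hw0 using hgen
  let π : (s →₀ R) →ₗ[R] W := Finsupp.linearCombination R w
  -- `ρ` projects the free module onto `⨁ R e_T`, through which `π` factors.
  let ρ : (s →₀ R) →ₗ[R] (s →₀ R) :=
    Finsupp.linearCombination R fun T => Finsupp.single T (e T)
  have hπs : ∀ T a, π (Finsupp.single T a) = a • w T := fun T a => by simp [π]
  have hρ : ∀ x T, ρ x T = x T * e T := by
    intro x T
    induction x using Finsupp.induction_linear with
    | zero => simp
    | add x y hx hy => rw [map_add, Finsupp.add_apply, hx, hy, Finsupp.add_apply, add_mul]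
    | single T' a =>
      by_cases hT : T' = T
      · subst hT; simp [ρ]
      · simp [ρ, hT]
  have hπρ : ∀ x, π (ρ x) = π x := by
    intro x
    induction x using Finsupp.induction_linear with
    | zero => simp
    | add x y hx hy => simp only [map_add, hx, hy]
    | single T a =>
      rw [hπs, show ρ (Finsupp.single T a) = a • Finsupp.single T (e T) from
        Finsupp.linearCombination_single R a T, map_smul, hπs, hew]
  have hρρ : ∀ x, ρ (ρ x) = ρ x := by
    intro x
    ext T
    rw [hρ, hρ, mul_assoc, h.mul_self _ (he T)]
  have hsurj : LinearMap.range π = ⊤ := by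
    apply Submodule.eq_top_of_sup_smul_top_eq_top hn
    have hmap : (LinearMap.range π).map JW.mkQ = ⊤ := by
      rw [eq_top_iff, ← hs]
      refine sSup_le fun T hT => ?_
      have hle : Submodule.span R {JW.mkQ (w ⟨T, hT⟩)} ≤ T := by simpa using hwT ⟨T, hT⟩
      rw [← ((hatom hT).le_iff_eq (by simpa using hw0 ⟨T, hT⟩)).1 hle,
        Submodule.span_singleton_le_iff_mem]
      exact ⟨_, ⟨Finsupp.single ⟨T, hT⟩ 1, by rw [hπs, one_smul]⟩, rfl⟩
    have := congrArg (Submodule.comap JW.mkQ) hmap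
    rwa [Submodule.comap_map_mkQ, Submodule.comap_top, sup_comm] at this
  have hmemJ : ∀ x, π x = 0 → ∀ T, ρ x T ∈ J := by
    intro x hx T
    by_contra hxT
    have hxT' : x T * e T ∉ J := by rwa [← hρ]
    have hsum : ∑ T ∈ x.support, x T • JW.mkQ (w T) = 0 := by
      have := congrArg JW.mkQ hx
      rw [map_zero, Finsupp.linearCombination_apply, Finsupp.sum, map_sum] at this
      simpa only [map_smul] using this
    have hzero := (iSupIndep_iff_finsetSum_eq_zero_imp_eq_zero _).1 ((sSupIndep_iff s).1 hind)
      x.support (fun T => x T • JW.mkQ (w T)) (fun T _ => T.1.smul_mem _ (hwT T)) hsum T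
      (Finsupp.mem_support_iff.2 fun h0 => hxT' (by rw [h0, zero_mul]; exact J.zero_mem))
    obtain ⟨y, hy⟩ := h.exists_mul_eq _ (he T) (x T * e T)
      (by rw [mul_assoc, h.mul_self _ (he T)]) hxT'
    apply hw0 T
    rw [← hew T, ← hy, mul_smul, mul_smul, hew, map_smul, map_smul, hzero, smul_zero]
  -- With `g` a local section of `π`, `∑ ρ x T • g (w T) = g (π x) = 0`. So `ρ x` combines the
  -- images under `ρ` of kernel elements `single T 1 - g (w T)`, with coefficients in `J`: each
  -- round gains a factor of `J`.
  have hpow : ∀ k x, π x = 0 → ∀ T, ρ x T ∈ J ^ k := by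
    intro k
    induction k with
    | zero => intro x _ T; rw [Submodule.pow_zero, Ideal.one_eq_top]; trivial
    | succ k ih =>
      intro x hx T
      obtain ⟨g, hg⟩ := hW (s →₀ R) W π LinearMap.id
        (Submodule.span R ((ρ x).support.image w : Finset W)) (LinearMap.range_eq_top.1 hsurj)
        ⟨_, rfl⟩
      have hgw : ∀ T ∈ (ρ x).support, π (g (w T)) = w T := fun T hT =>
        hg _ (Submodule.subset_span (Finset.mem_image_of_mem w hT))
      have hk : ρ x = ∑ T ∈ (ρ x).support, ρ x T • ρ (Finsupp.single T 1 - g (w T)) := by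
        have h0 : ∑ T ∈ (ρ x).support, ρ x T • w T = 0 := by
          rw [← hx, ← hπρ x]
          exact (Finsupp.linearCombination_apply R (ρ x)).symm
        have h1 := congrArg (fun v => ρ (g v)) h0
        simp only [map_sum, map_smul, map_zero] at h1
        simp only [map_sub, smul_sub, Finset.sum_sub_distrib]
        rw [h1, sub_zero]
        conv_lhs => rw [← hρρ x]
        exact Finsupp.linearCombination_apply R (ρ x) |>.trans (by simp [Finsupp.sum, ρ])
      rw [hk, Finsupp.finsetSum_apply, Ideal.IsTwoSided.pow_succ]
      refine Ideal.sum_mem _ fun T' hT' => ?_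
      rw [Finsupp.smul_apply, smul_eq_mul]
      exact Ideal.mul_mem_mul (hmemJ x hx T')
        (ih _ (by rw [map_sub, hπs, one_smul, hgw T' hT', sub_self]) T)
  have hker : LinearMap.ker π ≤ LinearMap.ker ρ := by
    intro x hx
    rw [LinearMap.mem_ker]
    ext T
    have := hpow n x hx T
    rwa [hn] at this
  let σ : W →ₗ[R] (s →₀ R) := ((LinearMap.ker π).liftQ ρ hker).comp
    (π.quotKerEquivOfSurjective (LinearMap.range_eq_top.1 hsurj)).symm.toLinearMap
  refine Module.Projective.of_split σ π ?_
  ext v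
  obtain ⟨x, rfl⟩ := LinearMap.range_eq_top.1 hsurj v
  have hσ : σ (π x) = ρ x := by
    have : (π.quotKerEquivOfSurjective (LinearMap.range_eq_top.1 hsurj)).symm (π x) =
        (LinearMap.ker π).mkQ x := by
      rw [LinearEquiv.symm_apply_eq]
      rfl
    simp only [σ, LinearMap.comp_apply, LinearEquiv.coe_coe, this]
    rfl
  rw [LinearMap.comp_apply, hσ, hπρ, LinearMap.id_apply]

end LocallyProjective

theorem mainTheorem3 {R V W : Type u} [Ring R] [AddCommGroup V] [Module Rᵐᵒᵖ V]
    [AddCommGroup W] [Module R W] (κ : V →ₗ[Rᵐᵒᵖ] (W →ₗ[R] R)) :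
    (Module.Injective Rᵐᵒᵖ R ∧ IsCogenerator Rᵐᵒᵖ R →
      List.TFAE
        [IsLocallyProjective R W ∧ LeftPairing.IsDense κ,
          SatisfiesAlpha R W ∧ LeftPairing.IsDense κ,
          LeftPairing.IsAlpha κ,
          SatisfiesAlpha R W ∧ Function.Injective (LeftPairing.chi κ)]) ∧
    (IsQFRing R →
      List.TFAE
        [IsLocallyProjective R W ∧ LeftPairing.IsDense κ,
          SatisfiesAlpha R W ∧ LeftPairing.IsDense κ,
          LeftPairing.IsAlpha κ,
          SatisfiesAlpha R W ∧ Function.Injective (LeftPairing.chi κ),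
          Module.Projective R W ∧ Function.Injective (LeftPairing.chi κ),
          IsPureEmbedding (LeftPairing.chiFun κ)]) := by
  have hloc : IsLocallyProjective R W ↔ SatisfiesAlpha R W :=
    LeftPairing.isLocallyProjective_iff.trans LeftPairing.isAlpha_iff.symm
  have h23 : SatisfiesAlpha R W ∧ LeftPairing.IsDense κ → LeftPairing.IsAlpha κ := fun h =>
    LeftPairing.isAlpha_iff.2
      (LeftPairing.hasLocalDualBases_of_isDense (LeftPairing.isAlpha_iff.1 h.1) h.2)
  have h34 : LeftPairing.IsAlpha κ → SatisfiesAlpha R W ∧ Function.Injective (LeftPairing.chi κ) :=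
    fun h => ⟨LeftPairing.isAlpha_iff.2 (LeftPairing.isAlpha_iff.1 h).id,
      (LeftPairing.isAlpha_iff.1 h).chi_injective⟩
  have h42 : IsCogenerator Rᵐᵒᵖ R → SatisfiesAlpha R W ∧ Function.Injective (LeftPairing.chi κ) →
      SatisfiesAlpha R W ∧ LeftPairing.IsDense κ :=
    fun hR h => ⟨h.1, LeftPairing.isDense_of_chi_injective hR h.2⟩
  refine ⟨fun hR => ?_, fun hR => ?_⟩
  · tfae_have 1 ↔ 2 := and_congr_left' hloc
    tfae_have 2 → 3 := h23
    tfae_have 3 → 4 := h34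
    tfae_have 4 → 2 := h42 hR.2
    tfae_finish
  · have := hR.1
    tfae_have 1 ↔ 2 := and_congr_left' hloc
    tfae_have 2 → 3 := h23
    tfae_have 3 → 4 := h34
    tfae_have 4 → 2 := h42 hR.2
    tfae_have 4 → 5 := fun h => by
      obtain ⟨J, E, hJE⟩ := hR.exists_isSemiprimarySystem
      exact ⟨hJE.projective (hloc.2 h.1), h.2⟩
    tfae_have 5 → 4 := fun ⟨_, h⟩ => ⟨hloc.1 LeftPairing.isLocallyProjective_of_projective, h⟩
    tfae_have 3 → 6 := LeftPairing.IsAlpha.isPureEmbedding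
    tfae_have 6 → 3 := LeftPairing.isAlpha_of_isPureEmbedding
    tfae_finish
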